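/- For a group $G$ and an endomorphism $\varphi$ of $G$, let $R(\varphi)\in\mathbb N\cup\{\infty\}$ be the number of $\varphi$-twisted conjugacy classes, i.e. of orbits of the action $\sigma\cdot\alpha=\sigma\alpha\varphi(\sigma)^{-1}$ of $G$ on itself. $G$ has the $R_\infty$ property if $R(\varphi)=\infty$ for every automorphism $\varphi$ of $G$. Let $\Gamma_1(G)=G$ and $\Gamma_{n+1}(G)=[\Gamma_n(G),G]$, let $F_2$ be the free group on two generators, and put $G(2,k)=F_2/\Gamma_{k+1}(F_2)$ for a positive integer $k$ and $G(2,\infty)=F_2$. **Theorem.** (1) $G(2,k)$ has the $R_\infty$ property for every integer $k\ge 8$ and for $k=\infty$. In particular, every automorphism of $F_2$ has infinitely many twisted conjugacy classes. (2) Let $8\le k\le\infty$ and $G=G(2,k)$, let $x,y\in G$ be the images of the two free generators of $F_2$, and let $B=[x,y]$, where $[a,b]=aba^{-1}b^{-1}$. Then $[B,[[B,x],[B,y]]]\in\Gamma_8(G)$, its class in $\Gamma_8(G)/\Gamma_9(G)$ is nontrivial, and for every automorphism $\varphi$ of $G$ whose induced automorphism $\varphi^{Ab}$ of the abelianization $G^{Ab}\cong\mathbb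 Z^2$ has determinant $-1$, this class is fixed by the automorphism of $\Gamma_8(G)/\Gamma_9(G)$ induced by $\varphi$. -/

import Mathlib

open scoped commutatorElement

/-- The `φ`-twisted conjugacy relation: the orbit relation of the action
`σ · α = σ α φ(σ)⁻¹` of `G` on itself. -/
def twistedConj {G : Type*} [Group G] (φ : G →* G) : Setoid G where
  r α β := ∃ σ : G, β = σ * α * (φ σ)⁻¹
  iseqv :=
    { refl := fun α => ⟨1, by simp⟩
      symm := by
        rintro α β ⟨σ, rfl⟩
        exact ⟨σ⁻¹, by simp [mul_assoc]⟩
      trans := by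
        rintro α β γ ⟨σ, rfl⟩ ⟨τ, rfl⟩
        exact ⟨τ * σ, by simp [mul_assoc]⟩ }

/-- The Reidemeister number `R(φ)`: the number of `φ`-twisted conjugacy classes, in `ℕ ∪ {∞}`. -/
noncomputable def reidemeisterNumber {G : Type*} [Group G] (φ : G →* G) : ℕ∞ :=
  ENat.card (Quotient (twistedConj φ))

/-- The `R_∞` property: every automorphism has infinite Reidemeister number. -/
def HasRInfty (G : Type*) [Group G] : Prop :=
  ∀ φ : G ≃* G, reidemeisterNumber φ.toMonoidHom = ⊤

/-- The `n`-th term `Γ_n(G)` of the lower central series for `n ≥ 1`, numbered so that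
`Γ_1(G) = G` and `Γ_{n+1}(G) = [Γ_n(G), G]`. (Mathlib's numbering starts at `0`; the value at
`n = 0` is irrelevant.) -/
abbrev Gam (G : Type*) [Group G] (n : ℕ) : Subgroup G :=
  (⊤ : Subgroup G).lowerCentralSeries (n - 1)

theorem map_mem_Gam {G H : Type*} [Group G] [Group H] (φ : G →* H) (n : ℕ) {g : G}
    (hg : g ∈ Gam G n) : φ g ∈ Gam H n := by
  have h : φ g ∈ (Gam G n).map φ := Subgroup.mem_map_of_mem φ hg
  rw [Subgroup.map_lowerCentralSeries] at h
  have mono : ∀ m : ℕ, ((⊤ : Subgroup G).map φ).lowerCentralSeries m ≤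
      (⊤ : Subgroup H).lowerCentralSeries m := by
    intro m
    induction m with
    | zero => exact le_top
    | succ m ih => exact Subgroup.commutator_mono ih le_top
  exact mono _ h

/-- The factor `Γ_n(G) / Γ_{n+1}(G)`. -/
abbrev GamFactor (G : Type*) [Group G] (n : ℕ) : Type _ :=
  Gam G n ⧸ (Gam G (n + 1)).subgroupOf (Gam G n)

/-- The restriction `Γ_n(G) → Γ_n(G)` of an endomorphism of `G`. -/
def gamRestrict {G : Type*} [Group G] (φ : G →* G) (n : ℕ) : Gam G n →* Gam G n :=
  (φ.comp (Gam G n).subtype).codRestrict (Gam G n) fun g => map_mem_Gam φ n g.2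

/-- The endomorphism of `Γ_n(G) / Γ_{n+1}(G)` induced by an endomorphism of `G`. -/
def gamFactorMap {G : Type*} [Group G] (φ : G →* G) (n : ℕ) : GamFactor G n →* GamFactor G n :=
  QuotientGroup.map _ _ (gamRestrict φ n) fun _ hg => map_mem_Gam φ (n + 1) hg

/-- The determinant of the endomorphism `φ^{Ab}` of the abelianization `G^{Ab}`, written
additively as a `ℤ`-module. (It is used for groups whose abelianization is free abelian of
rank two.) -/
noncomputable def abDet {G : Type*} [Group G] (φ : G →* G) : ℤ :=
  LinearMap.det (MonoidHom.toAdditive (Abelianization.map φ)).toIntLinearMap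

/-- The free nilpotent group `G(r,k) = F_r / Γ_{k+1}(F_r)` of rank `r` and class `k`. -/
abbrev FreeNilpotentGroup (r k : ℕ) : Type :=
  FreeGroup (Fin r) ⧸ Gam (FreeGroup (Fin r)) (k + 1)

/-- The `i`-th standard generator of `G(r,k)`. -/
def FreeNilpotentGroup.gen {r : ℕ} (k : ℕ) (i : Fin r) : FreeNilpotentGroup r k :=
  QuotientGroup.mk (FreeGroup.of i)

/-- The element `[B, [[B,x],[B,y]]]`, where `B = [x,y]` and `[a,b] = a b a⁻¹ b⁻¹`. -/
def weightEight {G : Type*} [Group G] (x y : G) : G :=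
  ⁅⁅x, y⁆, ⁅⁅⁅x, y⁆, x⁆, ⁅⁅x, y⁆, y⁆⁆⁆

/-! Let `w = [B,[[B,x],[B,y]]]`. Commutators are bilinear on the graded pieces of the lower central
series. If an endomorphism acts on the abelianization by a matrix M of determinant D, it multiplies
the class of B by D, acts on the span of `[B,x]`, `[B,y]` by D·M, and so multiplies the class of
their commutator by det(D·M) = D³. Hence the class of `w` modulo Γ_9 is multiplied by D⁴
(`gamEq_weightEight`), which is 1 for an automorphism. A unitriangular representation that kills Γ_9
but no nonzero power of `w` shows that this class has infinite order
(`weightEight_freeGroup_zpow_notMem`).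

It remains to see that fixing a class of infinite order in some Γ_n/Γ_{n+1} makes the Reidemeister
number infinite (`infinite_twistedConj`). Take n minimal. By rank-nullity, `id - φ` has image of
infinite index in Γ_n/Γ_{n+1}. Elements of Γ_n can be twisted conjugate only through some σ fixed
modulo Γ_n, and then they differ modulo Γ_{n+1} by σφ(σ)⁻¹. By minimality Γ_n has finite index among
such σ, so these displacements still form a subgroup of infinite index, and its cosets separate
infinitely many twisted classes. -/

/-! ### Commutator calculus in the lower central series -/

section LowerCentralSeries
variable {G : Type*} [Group G]

theorem gam_succ {n : ℕ} (hn : 1 ≤ n) : Gam G (n + 1) = ⁅Gam G n, (⊤ : Subgroup G)⁆ := by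
  obtain ⟨m, rfl⟩ := Nat.exists_eq_add_of_le' hn
  rfl

theorem gam_one : Gam G 1 = ⊤ := rfl

theorem mem_gam_one (g : G) : g ∈ Gam G 1 := Subgroup.mem_top g

theorem gam_antitone {m n : ℕ} (h : m ≤ n) : Gam G n ≤ Gam G m :=
  Subgroup.lowerCentralSeries_antitone _ (Nat.sub_le_sub_right h 1)

/-- The three subgroups lemma, relative to a normal subgroup. -/
theorem Subgroup.commutator_commutator_le_of_rotate {H₁ H₂ H₃ N : Subgroup G} [N.Normal]
    (h1 : ⁅⁅H₂, H₃⁆, H₁⁆ ≤ N) (h2 : ⁅⁅H₃, H₁⁆, H₂⁆ ≤ N) : ⁅⁅H₁, H₂⁆, H₃⁆ ≤ N := by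
  have key : ∀ K : Subgroup G, K ≤ N ↔ K.map (QuotientGroup.mk' N) = ⊥ := fun K => by
    rw [Subgroup.map_eq_bot_iff, QuotientGroup.ker_mk']
  rw [key, Subgroup.map_commutator, Subgroup.map_commutator] at h1 h2 ⊢
  exact Subgroup.commutator_commutator_eq_bot_of_rotate h1 h2

/-- Induction on `j` by the three subgroups lemma. Index 0 is a second copy of the whole group,
hence the separate cases. -/
theorem commutator_gam_le (i j : ℕ) : ⁅Gam G i, Gam G j⁆ ≤ Gam G (i + j) := by
  induction j using Nat.strong_induction_on generalizing i with
  | _ j ih =>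
    match j with
    | 0 => exact Subgroup.commutator_le_left _ _
    | 1 =>
      rcases Nat.eq_zero_or_pos i with rfl | hi
      · exact le_top
      · exact (gam_succ hi).ge
    | j + 2 =>
      rcases Nat.eq_zero_or_pos i with rfl | hi
      · rw [zero_add]; exact Subgroup.commutator_le_right _ _
      rw [gam_succ (n := j + 1) (by omega), Subgroup.commutator_comm]
      refine Subgroup.commutator_commutator_le_of_rotate ?_ ?_
      · rw [Subgroup.commutator_comm ⊤, ← gam_succ hi]
        exact (ih (j + 1) (by omega) (i + 1)).trans (gam_antitone (by omega))
      · rw [show i + (j + 2) = i + (j + 1) + 1 by omega, gam_succ (n := i + (j + 1)) (by omega)]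
        exact Subgroup.commutator_mono (ih (j + 1) (by omega) i) le_rfl

theorem commutator_mem_gam {i j k : ℕ} {g h : G} (hg : g ∈ Gam G i) (hh : h ∈ Gam G j)
    (hk : k ≤ i + j) : ⁅g, h⁆ ∈ Gam G k :=
  gam_antitone hk (commutator_gam_le i j (Subgroup.commutator_mem_commutator hg hh))

/-- Congruence modulo the `n`-th term of the lower central series. -/
def GamEq (n : ℕ) (g h : G) : Prop := (QuotientGroup.mk g : G ⧸ Gam G n) = QuotientGroup.mk h

theorem gamEq_one_iff {n : ℕ} {g : G} : GamEq n g 1 ↔ g ∈ Gam G n := by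
  rw [GamEq, QuotientGroup.mk_one, QuotientGroup.eq_one_iff]

theorem GamEq.refl {n : ℕ} (g : G) : GamEq n g g := rfl
theorem GamEq.symm {n : ℕ} {g h : G} (e : GamEq n g h) : GamEq n h g := Eq.symm e
theorem GamEq.trans {n : ℕ} {g h k : G} (e : GamEq n g h) (f : GamEq n h k) : GamEq n g k :=
  Eq.trans e f

theorem GamEq.mul {n : ℕ} {g g' h h' : G} (e : GamEq n g g') (f : GamEq n h h') :
    GamEq n (g * h) (g' * h') := by
  simp only [GamEq, QuotientGroup.mk_mul] at *; rw [e, f]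

theorem GamEq.inv {n : ℕ} {g g' : G} (e : GamEq n g g') : GamEq n g⁻¹ g'⁻¹ := by
  simp only [GamEq, QuotientGroup.mk_inv] at *; rw [e]

theorem GamEq.zpow {n : ℕ} {g g' : G} (e : GamEq n g g') (m : ℤ) : GamEq n (g ^ m) (g' ^ m) := by
  simp only [GamEq, QuotientGroup.mk_zpow] at *; rw [e]

theorem GamEq.mem_iff {n m : ℕ} {g g' : G} (e : GamEq n g g') (h : m ≤ n) :
    g ∈ Gam G m ↔ g' ∈ Gam G m := by
  have := gam_antitone h (QuotientGroup.eq.1 e)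
  exact ⟨fun hg => by simpa using mul_mem hg this,
    fun hg => by simpa using mul_mem hg (inv_mem this)⟩

theorem gamEq_mul_comm {i j n : ℕ} {g h : G} (hg : g ∈ Gam G i) (hh : h ∈ Gam G j)
    (hn : n ≤ i + j) : GamEq n (g * h) (h * g) := by
  have := gamEq_one_iff.2 (commutator_mem_gam hg hh hn)
  simpa [commutatorElement_def] using this.mul (GamEq.refl (h * g))

/-- The error terms come from moving `g` past `[g',h]`, of weight 2i + j, and from swapping the two
commutators, of weight 2i + 2j; the first is deep enough because i ≥ 1. -/
theorem gamEq_commutator_mul_left {i j n : ℕ} (hi : 1 ≤ i) {g g' h : G} (hg : g ∈ Gam G i)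
    (hg' : g' ∈ Gam G i) (hh : h ∈ Gam G j) (hn : n = i + j + 1) :
    GamEq n ⁅g * g', h⁆ (⁅g, h⁆ * ⁅g', h⁆) := by
  have e : ⁅g * g', h⁆ = (g * ⁅g', h⁆) * (g⁻¹ * ⁅g, h⁆) := by
    simp only [commutatorElement_def]; group
  have h1 : GamEq n (g * ⁅g', h⁆) (⁅g', h⁆ * g) :=
    gamEq_mul_comm hg (commutator_mem_gam hg' hh le_rfl) (by omega)
  rw [e]
  refine (h1.mul (GamEq.refl _)).trans ?_
  rw [show ⁅g', h⁆ * g * (g⁻¹ * ⁅g, h⁆) = ⁅g', h⁆ * ⁅g, h⁆ by group]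
  exact gamEq_mul_comm (commutator_mem_gam hg' hh le_rfl) (commutator_mem_gam hg hh le_rfl)
    (by omega)

theorem gamEq_commutator_mul_right {i j n : ℕ} (hi : 1 ≤ i) {g g' h : G} (hg : g ∈ Gam G i)
    (hg' : g' ∈ Gam G i) (hh : h ∈ Gam G j) (hn : n = i + j + 1) :
    GamEq n ⁅h, g * g'⁆ (⁅h, g⁆ * ⁅h, g'⁆) := by
  have := (gamEq_commutator_mul_left hi hg hg' hh hn).inv
  rw [commutatorElement_inv, mul_inv_rev, commutatorElement_inv, commutatorElement_inv] at this
  exact this.trans (gamEq_mul_comm (commutator_mem_gam hh hg' le_rfl)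
    (commutator_mem_gam hh hg le_rfl) (by omega))

theorem gamEq_commutator_zpow_left {i j n : ℕ} (hi : 1 ≤ i) {g h : G} (hg : g ∈ Gam G i)
    (hh : h ∈ Gam G j) (hn : n = i + j + 1) (m : ℤ) : GamEq n ⁅g ^ m, h⁆ (⁅g, h⁆ ^ m) := by
  induction m with
  | zero => simpa using GamEq.refl _
  | succ m ih =>
    rw [zpow_add_one, zpow_add_one]
    exact (gamEq_commutator_mul_left hi (zpow_mem hg _) hg hh hn).trans (ih.mul (GamEq.refl _))
  | pred m ih =>
    have := gamEq_commutator_mul_left hi (zpow_mem hg (-(m : ℤ) - 1)) hg hh hn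
    rw [← zpow_add_one, sub_add_cancel] at this
    rw [zpow_sub_one ⁅g, h⁆]
    have h2 := (this.symm.trans ih).mul (GamEq.refl (n := n) ⁅g, h⁆⁻¹)
    rwa [mul_inv_cancel_right] at h2

theorem gamEq_commutator_zpow_right {i j n : ℕ} (hi : 1 ≤ i) {g h : G} (hg : g ∈ Gam G i)
    (hh : h ∈ Gam G j) (hn : n = i + j + 1) (m : ℤ) : GamEq n ⁅h, g ^ m⁆ (⁅h, g⁆ ^ m) := by
  have := (gamEq_commutator_zpow_left hi hg hh hn m).inv
  rwa [commutatorElement_inv, ← inv_zpow, commutatorElement_inv] at this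

/-- With its two-variable form `GamEq.commutator`, this makes the bracket well defined on graded
pieces. -/
theorem GamEq.commutator_left {i j n : ℕ} (hi : 1 ≤ i) {g g' h : G} (hg : g ∈ Gam G i)
    (e : GamEq (i + 1) g g') (hh : h ∈ Gam G j) (hn : n = i + j + 1) :
    GamEq n ⁅g, h⁆ ⁅g', h⁆ := by
  have hz : g⁻¹ * g' ∈ Gam G (i + 1) := QuotientGroup.eq.1 e
  have := gamEq_commutator_mul_left hi hg (gam_antitone (by omega) hz) hh hn
  rw [mul_inv_cancel_left] at this
  refine (this.trans ?_).symm
  simpa using (GamEq.refl ⁅g, h⁆).mul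
    (gamEq_one_iff.2 (commutator_mem_gam (k := n) hz hh (by omega)))

theorem GamEq.commutator {i j n : ℕ} (hi : 1 ≤ i) (hj : 1 ≤ j) {g g' h h' : G}
    (hg : g ∈ Gam G i) (e : GamEq (i + 1) g g') (hh : h ∈ Gam G j) (f : GamEq (j + 1) h h')
    (hn : n = i + j + 1) : GamEq n ⁅g, h⁆ ⁅g', h'⁆ := by
  refine (e.commutator_left hi hg hh hn).trans ?_
  have hg' := (e.mem_iff (Nat.le_succ i)).1 hg
  have := (f.commutator_left hj hh hg' (n := n) (by omega)).inv
  rwa [commutatorElement_inv, commutatorElement_inv] at this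

/-- The commutator form on `Γ_i / Γ_{i+1}` restricted to the span of two elements. -/
theorem gamEq_commutator_linear_comb {i n : ℕ} (hi : 1 ≤ i) {u v : G} (hu : u ∈ Gam G i)
    (hv : v ∈ Gam G i) (hn : n = i + i + 1) (a b c d : ℤ) :
    GamEq n ⁅u ^ a * v ^ b, u ^ c * v ^ d⁆ (⁅u, v⁆ ^ (a * d - b * c)) := by
  have hl := zpow_mem hu a
  have hr := zpow_mem hv b
  have key : ∀ {s t : G}, s ∈ Gam G i → t ∈ Gam G i → ∀ k l : ℤ,
      GamEq n ⁅s ^ k, t ^ l⁆ (⁅s, t⁆ ^ (k * l)) := fun hs ht k l => by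
    rw [zpow_mul]
    exact (gamEq_commutator_zpow_right hi ht (zpow_mem hs k) hn l).trans
      ((gamEq_commutator_zpow_left hi hs ht hn k).zpow l)
  refine (gamEq_commutator_mul_left hi hl hr (mul_mem (zpow_mem hu c) (zpow_mem hv d)) hn).trans ?_
  have e1 : GamEq n ⁅u ^ a, u ^ c * v ^ d⁆ (⁅u, v⁆ ^ (a * d)) := by
    refine (gamEq_commutator_mul_right hi (zpow_mem hu c) (zpow_mem hv d) hl hn).trans ?_
    simpa using (key hu hu a c).mul (key hu hv a d)
  have e2 : GamEq n ⁅v ^ b, u ^ c * v ^ d⁆ (⁅u, v⁆ ^ (-(b * c))) := by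
    refine (gamEq_commutator_mul_right hi (zpow_mem hu c) (zpow_mem hv d) hr hn).trans ?_
    have := (key hv hu b c).mul (key hv hv b d)
    rwa [commutatorElement_self, one_zpow, mul_one, ← commutatorElement_inv u v, inv_zpow,
      ← zpow_neg] at this
  have := e1.mul e2
  rwa [← zpow_add] at this

theorem weightEight_mem (x y : G) : weightEight x y ∈ Gam G 8 := by
  have hx : ∀ z : G, z ∈ Gam G 1 := mem_gam_one
  have hB := commutator_mem_gam (k := 2) (hx x) (hx y) le_rfl
  exact commutator_mem_gam hB (commutator_mem_gam (k := 6)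
    (commutator_mem_gam (k := 3) hB (hx x) le_rfl)
    (commutator_mem_gam (k := 3) hB (hx y) le_rfl) le_rfl) le_rfl

/-- The exponent collects one D from the outer B and D³ from the inner bracket: one D from each of
its two copies of B, and one from the determinant of the substitution itself. -/
theorem gamEq_weightEight {x y X Y : G} {a b c d : ℤ} (hX : GamEq 2 X (x ^ a * y ^ b))
    (hY : GamEq 2 Y (x ^ c * y ^ d)) :
    GamEq 9 (weightEight X Y) (weightEight x y ^ (a * d - b * c) ^ 4) := by
  set D := a * d - b * c with hD
  have hx : ∀ z : G, z ∈ Gam G 1 := mem_gam_one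
  have hB : ⁅x, y⁆ ∈ Gam G 2 := commutator_mem_gam (hx x) (hx y) le_rfl
  have hu : ⁅⁅x, y⁆, x⁆ ∈ Gam G 3 := commutator_mem_gam hB (hx x) le_rfl
  have hv : ⁅⁅x, y⁆, y⁆ ∈ Gam G 3 := commutator_mem_gam hB (hx y) le_rfl
  have hz := commutator_mem_gam (k := 6) hu hv le_rfl
  have hB' : ⁅X, Y⁆ ∈ Gam G 2 := commutator_mem_gam (hx X) (hx Y) le_rfl
  have hu' : ⁅⁅X, Y⁆, X⁆ ∈ Gam G 3 := commutator_mem_gam hB' (hx X) le_rfl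
  have hv' : ⁅⁅X, Y⁆, Y⁆ ∈ Gam G 3 := commutator_mem_gam hB' (hx Y) le_rfl
  have hz' := commutator_mem_gam (k := 6) hu' hv' le_rfl
  have eB : GamEq 3 ⁅X, Y⁆ (⁅x, y⁆ ^ D) :=
    (hX.commutator le_rfl le_rfl (hx X) (hx Y) hY rfl).trans
      (gamEq_commutator_linear_comb le_rfl (hx x) (hx y) rfl a b c d)
  have eu : ∀ {Z : G} {k l : ℤ}, GamEq 2 Z (x ^ k * y ^ l) →
      GamEq 4 ⁅⁅X, Y⁆, Z⁆ (⁅⁅x, y⁆, x⁆ ^ (D * k) * ⁅⁅x, y⁆, y⁆ ^ (D * l)) := fun {Z k l} hZ => by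
    refine (eB.commutator (by omega) le_rfl hB' (hx Z) hZ rfl).trans ?_
    refine (gamEq_commutator_zpow_left (by omega) hB (hx _) rfl D).trans ?_
    have := (gamEq_commutator_mul_right le_rfl (hx (x ^ k)) (hx (y ^ l)) hB rfl).trans
      ((gamEq_commutator_zpow_right le_rfl (hx x) hB rfl k).mul
        (gamEq_commutator_zpow_right le_rfl (hx y) hB rfl l))
    refine (this.zpow D).trans ?_
    rw [mul_comm D, mul_comm D, zpow_mul, zpow_mul]
    -- The weight-3 factors commute modulo Γ_4, so the power D distributes over their product.
    have hc : GamEq 4 (⁅⁅x, y⁆, x⁆ ^ k * ⁅⁅x, y⁆, y⁆ ^ l) (⁅⁅x, y⁆, y⁆ ^ l * ⁅⁅x, y⁆, x⁆ ^ k) :=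
      gamEq_mul_comm (zpow_mem hu k) (zpow_mem hv l) (by omega)
    rw [GamEq, QuotientGroup.mk_mul, QuotientGroup.mk_mul] at hc
    have hc' : Commute (QuotientGroup.mk (⁅⁅x, y⁆, x⁆ ^ k) : G ⧸ Gam G 4)
      (QuotientGroup.mk (⁅⁅x, y⁆, y⁆ ^ l)) := hc
    simp only [GamEq, QuotientGroup.mk_mul, QuotientGroup.mk_zpow] at hc' ⊢
    exact hc'.mul_zpow D
  have ez : GamEq 7 ⁅⁅⁅X, Y⁆, X⁆, ⁅⁅X, Y⁆, Y⁆⁆ (⁅⁅⁅x, y⁆, x⁆, ⁅⁅x, y⁆, y⁆⁆ ^ D ^ 3) := by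
    refine ((eu hX).commutator (by omega) (by omega) hu' hv' (eu hY) rfl).trans ?_
    have := gamEq_commutator_linear_comb (n := 7) (by omega) hu hv rfl
      (D * a) (D * b) (D * c) (D * d)
    rwa [show D * a * (D * d) - D * b * (D * c) = D ^ 3 by rw [hD]; ring] at this
  refine (eB.commutator (by omega) (by omega) hB' hz' ez rfl).trans ?_
  refine (gamEq_commutator_zpow_left (by omega) hB (zpow_mem hz _) rfl D).trans ?_
  rw [show D ^ 4 = D ^ 3 * D by ring, zpow_mul]
  exact (gamEq_commutator_zpow_right (by omega) hz hB rfl _).zpow D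

end LowerCentralSeries

/-! ### The factors Γ_n/Γ_{n+1} are finitely generated abelian groups -/

section FiniteGeneration
variable {G : Type*} [Group G]

/-- Commutators of the previous generators with generators of `G` suffice: modulo these and the next
term, the previous generators become central, so the whole previous term does. -/
theorem exists_finite_gam_le_closure_sup [Group.FG G] (n : ℕ) :
    ∃ S : Set G, S.Finite ∧ S ⊆ Gam G (n + 1) ∧
      Gam G (n + 1) ≤ Subgroup.closure S ⊔ Gam G (n + 2) := by
  obtain ⟨T, hT, hTf⟩ := Group.fg_iff.1 (inferInstance : Group.FG G)
  induction n with
  | zero => exact ⟨T, hTf, fun _ _ => Subgroup.mem_top _, hT.symm.le.trans le_sup_left⟩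
  | succ n ih =>
    obtain ⟨S, hSf, hS, hle⟩ := ih
    set U : Set G := Set.image2 (fun s t => ⁅s, t⁆) S T
    have hUle : U ⊆ Gam G (n + 2) := by
      rintro _ ⟨s, hs, t, -, rfl⟩
      exact commutator_mem_gam (hS hs) (mem_gam_one t) le_rfl
    set K : Subgroup G := Subgroup.closure U ⊔ Gam G (n + 3)
    have hKle : K ≤ Gam G (n + 2) :=
      sup_le ((Subgroup.closure_le _).2 hUle) (gam_antitone (Nat.le_succ _))
    have : K.Normal := by
      rw [← Subgroup.commutator_top_right_le_iff]
      exact (Subgroup.commutator_mono hKle le_rfl).trans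
        ((gam_succ (n := n + 2) (by omega)).ge.trans le_sup_right)
    refine ⟨U, hSf.image2 _ hTf, hUle, ?_⟩
    have hcomm : ∀ g h : G, ⁅g, h⁆ ∈ K →
        (QuotientGroup.mk' K h) * (QuotientGroup.mk' K g) =
          (QuotientGroup.mk' K g) * (QuotientGroup.mk' K h) := fun g h hgh => by
      rw [← QuotientGroup.eq_one_iff] at hgh
      exact (commutatorElement_eq_one_iff_mul_comm.1
        ((map_commutatorElement (QuotientGroup.mk' K) g h).symm.trans hgh)).symm
    set C := (Subgroup.center (G ⧸ K)).comap (QuotientGroup.mk' K)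
    have hSC : S ⊆ C := fun s hs => by
      have h1 : Subgroup.closure T ≤
          (Subgroup.centralizer {QuotientGroup.mk' K s}).comap (QuotientGroup.mk' K) :=
        (Subgroup.closure_le _).2 fun t ht => Subgroup.mem_centralizer_singleton_iff.2
          (hcomm s t (Subgroup.mem_sup_left (Subgroup.subset_closure ⟨s, hs, t, ht, rfl⟩)))
      rw [hT] at h1
      refine Subgroup.mem_center_iff.2 fun q => ?_
      obtain ⟨h, rfl⟩ := QuotientGroup.mk'_surjective K q
      exact Subgroup.mem_centralizer_singleton_iff.1 (h1 (Subgroup.mem_top h))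
    have hΓC : Gam G (n + 2) ≤ C := fun g hg => by
      refine Subgroup.mem_center_iff.2 fun q => ?_
      obtain ⟨h, rfl⟩ := QuotientGroup.mk'_surjective K q
      exact hcomm g h (Subgroup.mem_sup_right
        (commutator_mem_gam hg (mem_gam_one h) le_rfl))
    have hall : Gam G (n + 1) ≤ C := hle.trans (sup_le ((Subgroup.closure_le _).2 hSC) hΓC)
    rw [show n + 1 + 1 = (n + 1) + 1 from rfl, gam_succ (n := n + 1) (by omega),
      Subgroup.commutator_le]
    intro g hg h _
    refine (QuotientGroup.eq_one_iff (N := K) _).1 ?_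
    refine (map_commutatorElement (QuotientGroup.mk' K) g h).trans ?_
    exact commutatorElement_eq_one_iff_mul_comm.2
      (Subgroup.mem_center_iff.1 (hall hg) (QuotientGroup.mk' K h)).symm

theorem fg_gamFactor [Group.FG G] {n : ℕ} (hn : 1 ≤ n) : Group.FG (GamFactor G n) := by
  obtain ⟨n, rfl⟩ := Nat.exists_eq_add_of_le' hn
  obtain ⟨S, hSf, hS, hle⟩ := exists_finite_gam_le_closure_sup (G := G) n
  have : Finite S := hSf
  set f : S → GamFactor G (n + 1) := fun s => QuotientGroup.mk ⟨s, hS s.2⟩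
  refine Group.fg_iff.2 ⟨Set.range f, eq_top_iff.2 fun q _ => ?_, Set.finite_range f⟩
  obtain ⟨⟨g, hg⟩, rfl⟩ := QuotientGroup.mk_surjective q
  set K := (Subgroup.closure (Set.range f)).comap (QuotientGroup.mk' _)
  have h1 : Gam G (n + 1) ≤ K.map (Gam G (n + 1)).subtype := by
    refine hle.trans (sup_le ((Subgroup.closure_le _).2 fun s hs => ?_) fun z hz => ?_)
    · exact ⟨⟨s, hS hs⟩, Subgroup.subset_closure ⟨⟨s, hs⟩, rfl⟩, rfl⟩
    · refine ⟨⟨z, gam_antitone (Nat.le_succ _) hz⟩, ?_, rfl⟩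
      have : (QuotientGroup.mk ⟨z, gam_antitone (Nat.le_succ _) hz⟩ : GamFactor G (n + 1)) = 1 :=
        (QuotientGroup.eq_one_iff _).2 hz
      exact (congrArg (· ∈ Subgroup.closure (Set.range f)) this).mpr (one_mem _)
  obtain ⟨⟨g', hg'⟩, hk, rfl⟩ := h1 hg
  exact hk

theorem gamFactor_mk_eq {n : ℕ} {g h : G} (hg : g ∈ Gam G n) (hh : h ∈ Gam G n) :
    (QuotientGroup.mk ⟨g, hg⟩ : GamFactor G n) = QuotientGroup.mk ⟨h, hh⟩ ↔ GamEq (n + 1) g h := by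
  rw [GamEq, QuotientGroup.eq, QuotientGroup.eq, Subgroup.mem_subgroupOf]
  rfl

theorem gamFactor_mk_eq_one {n : ℕ} {g : G} (hg : g ∈ Gam G n) :
    (QuotientGroup.mk ⟨g, hg⟩ : GamFactor G n) = 1 ↔ g ∈ Gam G (n + 1) :=
  QuotientGroup.eq_one_iff _

/-- The factors of the lower central series are commutative. -/
@[reducible] def gamFactorCommGroup {n : ℕ} (hn : 1 ≤ n) : CommGroup (GamFactor G n) :=
  { (inferInstance : Group (GamFactor G n)) with
    mul_comm := by
      intro a b
      obtain ⟨⟨g, hg⟩, rfl⟩ := QuotientGroup.mk_surjective a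
      obtain ⟨⟨h, hh⟩, rfl⟩ := QuotientGroup.mk_surjective b
      change (QuotientGroup.mk ⟨g * h, mul_mem hg hh⟩ : GamFactor G n) =
        QuotientGroup.mk ⟨h * g, mul_mem hh hg⟩
      exact (gamFactor_mk_eq _ _).2 (gamEq_mul_comm hg hh (by omega)) }

end FiniteGeneration

/-! ### A fixed class of infinite order forces infinitely many twisted classes -/

section TwistedConjugacy

/-- Index 0 encodes infinite index. A range of finite index has full rank, so by rank-nullity the
kernel would be torsion, contradicting `a`. -/
theorem MonoidHom.range_index_eq_zero_of_fg {A : Type*} [CommGroup A] [Group.FG A] (f : A →* A)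
    {a : A} (ha : f a = 1) (ho : ∀ m : ℤ, m ≠ 0 → a ^ m ≠ 1) : f.range.index = 0 := by
  by_contra hne
  have : Module.Finite ℤ (Additive A) := Module.Finite.iff_addGroup_fg.mpr inferInstance
  set F : Additive A →ₗ[ℤ] Additive A := (MonoidHom.toAdditive f).toIntLinearMap with hF
  have h1 := Submodule.finrank_quotient_add_finrank (LinearMap.range F)
  have h2 := Submodule.finrank_quotient_add_finrank (LinearMap.ker F)
  have h3 := (LinearMap.quotKerEquivRange F).finrank_eq
  have h4 : Module.finrank ℤ (Additive A ⧸ LinearMap.range F) = 0 := by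
    rw [Module.finrank_eq_zero_iff]
    intro q
    obtain ⟨b, rfl⟩ := Submodule.Quotient.mk_surjective _ q
    refine ⟨f.range.index, by exact_mod_cast hne, ?_⟩
    rw [← Submodule.Quotient.mk_smul, Submodule.Quotient.mk_eq_zero]
    obtain ⟨c, hc⟩ := f.range.pow_index_mem b.toMul
    refine ⟨Additive.ofMul c, ?_⟩
    rw [natCast_zsmul]
    exact congrArg Additive.ofMul hc
  have h5 : Module.finrank ℤ (LinearMap.ker F) = 0 := by omega
  rw [Module.finrank_eq_zero_iff] at h5
  obtain ⟨m, hm, e⟩ := h5 ⟨Additive.ofMul a, congrArg Additive.ofMul ha⟩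
  have e' := congrArg (fun z : LinearMap.ker F => (z : Additive A).toMul) e
  simp only [Submodule.coe_smul, toMul_zsmul, toMul_ofMul, ZeroMemClass.coe_zero, toMul_zero] at e'
  exact ho m hm e'

theorem CommGroup.finite_subgroup_of_fg {A : Type*} [CommGroup A] [Group.FG A] (K : Subgroup A)
    (h : ∀ a ∈ K, ∃ m : ℤ, m ≠ 0 ∧ a ^ m = 1) : Finite K := by
  have : Module.Finite ℤ (Additive A) := Module.Finite.iff_addGroup_fg.mpr inferInstance
  have : Finite (AddSubgroup.toIntSubmodule (Subgroup.toAddSubgroup K)) := by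
    refine Module.finite_of_fg_torsion _ fun {a} => ?_
    obtain ⟨m, hm, e⟩ := h a.1.toMul a.2
    refine ⟨⟨m, mem_nonZeroDivisors_of_ne_zero hm⟩, Subtype.ext ?_⟩
    exact congrArg Additive.ofMul e
  exact this

variable {G : Type*} [Group G]

/-- The elements fixed by `φ` modulo the `n`-th term of the lower central series. -/
def gamFixed (φ : G →* G) (n : ℕ) : Subgroup G :=
  MonoidHom.eqLocus (QuotientGroup.mk' (Gam G n)) ((QuotientGroup.mk' (Gam G n)).comp φ)

theorem mem_gamFixed {φ : G →* G} {n : ℕ} {g : G} :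
    g ∈ gamFixed φ n ↔ g * (φ g)⁻¹ ∈ Gam G n := by
  have : g ∈ gamFixed φ n ↔ (QuotientGroup.mk g : G ⧸ Gam G n) = QuotientGroup.mk (φ g) := Iff.rfl
  rw [this, ← gamEq_one_iff, GamEq, QuotientGroup.mk_mul, QuotientGroup.mk_inv,
    QuotientGroup.mk_one, mul_inv_eq_one]

theorem gam_le_gamFixed (φ : G →* G) (n : ℕ) : Gam G n ≤ gamFixed φ n := fun _ hg =>
  mem_gamFixed.2 (mul_mem hg (inv_mem (map_mem_Gam φ n hg)))

/-- `σ ↦ σ φ(σ)⁻¹`, a homomorphism on the elements fixed modulo `Γ_n`. -/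
def gamDisplacement (φ : G →* G) {n : ℕ} (hn : 1 ≤ n) : gamFixed φ n →* GamFactor G n where
  toFun σ := QuotientGroup.mk ⟨σ * (φ σ)⁻¹, mem_gamFixed.1 σ.2⟩
  map_one' := (gamFactor_mk_eq_one _).2 (by simp)
  map_mul' σ τ := by
    have hσ := mem_gamFixed.1 σ.2
    have hτ := mem_gamFixed.1 τ.2
    refine (gamFactor_mk_eq _ (mul_mem hσ hτ)).2 ?_
    have h1 : GamEq (n + 1) (σ * (τ * (φ τ)⁻¹)) (τ * (φ τ)⁻¹ * σ) :=
      gamEq_mul_comm (mem_gam_one _) hτ (by omega)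
    have h2 := (h1.mul (GamEq.refl (φ σ)⁻¹)).trans
      ((show τ * (φ τ)⁻¹ * σ * (φ σ)⁻¹ = (τ * (φ τ)⁻¹) * (σ * (φ σ)⁻¹) by group) ▸
        gamEq_mul_comm hτ hσ (by omega))
    convert h2 using 1
    simp only [Subgroup.coe_mul, map_mul]
    group

/-- `φ` fixes a class of infinite order in `Γ_n / Γ_{n+1}`. -/
def FixesInfiniteOrder (φ : G →* G) (n : ℕ) : Prop :=
  ∃ g ∈ Gam G n, g * (φ g)⁻¹ ∈ Gam G (n + 1) ∧ ∀ m : ℤ, m ≠ 0 → g ^ m ∉ Gam G (n + 1)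

/-- Climbing one weight at a time, each step costs only a finite index: an element of Γ_{i+1} fixed
modulo Γ_n gives a fixed class in weight i + 1 < n, which is torsion by hypothesis, and a torsion
subgroup of a finitely generated abelian group is finite. -/
theorem relIndex_gam_gamFixed_ne_zero [Group.FG G] (φ : G →* G) {n : ℕ}
    (hmin : ∀ i, 1 ≤ i → i < n → ¬ FixesInfiniteOrder φ i) {i : ℕ} (hi : i < n) :
    (Gam G (i + 1)).relIndex (gamFixed φ n) ≠ 0 := by
  induction i with
  | zero => rw [gam_one, Subgroup.relIndex_top_left]; exact one_ne_zero
  | succ i ih =>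
    have key := Subgroup.relIndex_inf_mul_relIndex (Gam G (i + 2)) (Gam G (i + 1)) (gamFixed φ n)
    rw [inf_eq_left.2 (gam_antitone (Nat.le_succ (i + 1)))] at key
    rw [← key]
    refine mul_ne_zero ?_ (ih (by omega))
    let := gamFactorCommGroup (G := G) (n := i + 1) (by omega)
    have : Group.FG (GamFactor G (i + 1)) := fg_gamFactor (by omega)
    set f : ↥(Gam G (i + 1) ⊓ gamFixed φ n) →* GamFactor G (i + 1) :=
      (QuotientGroup.mk' _).comp (Subgroup.inclusion inf_le_left)
    have hker : f.ker = (Gam G (i + 2)).subgroupOf (Gam G (i + 1) ⊓ gamFixed φ n) := by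
      ext z
      exact gamFactor_mk_eq_one z.2.1
    rw [Subgroup.relIndex, ← hker, Subgroup.index_ker]
    have : Finite f.range := CommGroup.finite_subgroup_of_fg _ (by
      rintro _ ⟨⟨z, hz₀, hz'⟩, rfl⟩
      have hz : z ∈ Gam G (i + 1) := hz₀
      have hno := hmin (i + 1) (by omega) hi
      simp only [FixesInfiniteOrder, not_exists, not_and, not_forall, not_not] at hno
      obtain ⟨m, hm, e⟩ := hno z hz (gam_antitone (by omega) (mem_gamFixed.1 hz'))
      exact ⟨m, hm, (gamFactor_mk_eq_one (zpow_mem hz m)).2 e⟩)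
    exact Nat.card_pos.ne'

/-- Let `n` be the first weight at which `φ` fixes a class of infinite order. Then the classes of
elements of `Γ_n` are already infinite in number. -/
theorem infinite_twistedConj [Group.FG G] (φ : G →* G) {n : ℕ} (hn : 1 ≤ n)
    (hmin : ∀ i, 1 ≤ i → i < n → ¬ FixesInfiniteOrder φ i) (hfix : FixesInfiniteOrder φ n) :
    Infinite (Quotient (twistedConj φ)) := by
  let := gamFactorCommGroup (G := G) hn
  have : Group.FG (GamFactor G n) := fg_gamFactor hn
  set δ := gamDisplacement φ hn
  have hindex : δ.range.index = 0 := by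
    obtain ⟨g, hg, hφ, ho⟩ := hfix
    -- On classes of Γ_n the displacement `δ` is `id - φ`, written multiplicatively.
    have hdiv : ∀ (z : G) (hz : z ∈ Gam G n),
        (MonoidHom.id (GamFactor G n) / gamFactorMap φ n) (QuotientGroup.mk ⟨z, hz⟩) =
          QuotientGroup.mk ⟨z * (φ z)⁻¹, mul_mem hz (inv_mem (map_mem_Gam φ n hz))⟩ :=
      fun z hz => div_eq_mul_inv _ _
    have h1 := MonoidHom.range_index_eq_zero_of_fg
      (MonoidHom.id (GamFactor G n) / gamFactorMap φ n) (a := QuotientGroup.mk ⟨g, hg⟩)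
      ((hdiv g hg).trans ((gamFactor_mk_eq_one _).2 hφ))
      fun m hm e => ho m hm ((gamFactor_mk_eq_one (zpow_mem hg m)).1 e)
    have h2 : (MonoidHom.id (GamFactor G n) / gamFactorMap φ n).range =
        ((Gam G n).subgroupOf (gamFixed φ n)).map δ := by
      ext q
      constructor
      · rintro ⟨a, rfl⟩
        obtain ⟨⟨z, hz⟩, rfl⟩ := QuotientGroup.mk_surjective a
        exact ⟨⟨z, gam_le_gamFixed φ n hz⟩, hz, (hdiv z hz).symm⟩
      · rintro ⟨⟨z, hz'⟩, hz, rfl⟩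
        exact ⟨QuotientGroup.mk ⟨z, hz⟩, hdiv z hz⟩
    -- The index of δ(Γ_n) is the index of Γ_n · ker δ times that of the range of `δ`. The first
    -- factor divides the finite index of Γ_n in `gamFixed φ n`, so the second must be infinite.
    rw [h2, Subgroup.index_map, mul_eq_zero] at h1
    refine h1.resolve_left fun h0 => ?_
    obtain ⟨i, rfl⟩ := Nat.exists_eq_add_of_le' hn
    exact relIndex_gam_gamFixed_ne_zero φ hmin (Nat.lt_succ_self i)
      (Nat.eq_zero_of_zero_dvd (h0 ▸ Subgroup.index_dvd_of_le le_sup_left))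
  have : Infinite (GamFactor G n ⧸ δ.range) := Subgroup.index_eq_zero_iff_infinite.1 hindex
  set p : Gam G n → GamFactor G n ⧸ δ.range := fun a => QuotientGroup.mk (QuotientGroup.mk a)
  have hp : Function.Surjective p :=
    QuotientGroup.mk_surjective.comp QuotientGroup.mk_surjective
  obtain ⟨s, hs⟩ := hp.hasRightInverse
  refine Infinite.of_injective
    (fun u : GamFactor G n ⧸ δ.range => Quotient.mk (twistedConj φ) (s u : G)) fun u v huv => ?_
  rw [← hs u, ← hs v]
  simp only at huv
  generalize s u = a at huv
  generalize s v = b at huv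
  obtain ⟨α, hα⟩ := a
  obtain ⟨β, hβ⟩ := b
  obtain ⟨σ, hσ⟩ := Quotient.exact huv
  simp only at hσ
  have hcomm : GamEq (n + 1) (σ * α) (α * σ) :=
    gamEq_mul_comm (mem_gam_one σ) hα (by omega)
  have e : GamEq (n + 1) β (α * (σ * (φ σ)⁻¹)) := by
    rw [hσ, ← mul_assoc]; exact hcomm.mul (GamEq.refl _)
  -- Since α and β both lie in Γ_n, the congruence `e` puts σφ(σ)⁻¹ there too.
  have hfixed : σ ∈ gamFixed φ n := mem_gamFixed.2 (by
    have := (e.mem_iff (Nat.le_succ n)).1 hβ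
    exact ((Gam G n).mul_mem_cancel_left hα).1 this)
  refine QuotientGroup.eq.2 ⟨⟨σ, hfixed⟩, ?_⟩
  rw [eq_inv_mul_iff_mul_eq]
  exact (gamFactor_mk_eq (mul_mem hα (mem_gamFixed.1 hfixed)) hβ).2 e.symm

end TwistedConjugacy

/-! ### Unitriangular integer matrices as a test for the lower central series -/

section Unitriangular
variable {N : ℕ}

/-- All entries below the `m`-th superdiagonal vanish. -/
def IsUpper (m : ℕ) (A : Matrix (Fin N) (Fin N) ℤ) : Prop :=
  ∀ i j : Fin N, (j : ℕ) < i + m → A i j = 0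

instance (m : ℕ) (A : Matrix (Fin N) (Fin N) ℤ) : Decidable (IsUpper m A) :=
  @Fintype.decidableForallFintype _ _
    (fun _ => @Fintype.decidableForallFintype _ _ (fun _ => instDecidableForall) _) _

theorem IsUpper.mono {m k : ℕ} {A : Matrix (Fin N) (Fin N) ℤ} (h : IsUpper m A) (hk : k ≤ m) :
    IsUpper k A := fun i j hij => h i j (by omega)

theorem IsUpper.add {m : ℕ} {A B : Matrix (Fin N) (Fin N) ℤ} (hA : IsUpper m A)
    (hB : IsUpper m B) : IsUpper m (A + B) := fun i j hij => by
  rw [Matrix.add_apply, hA i j hij, hB i j hij, add_zero]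

theorem IsUpper.sub {m : ℕ} {A B : Matrix (Fin N) (Fin N) ℤ} (hA : IsUpper m A)
    (hB : IsUpper m B) : IsUpper m (A - B) := fun i j hij => by
  rw [Matrix.sub_apply, hA i j hij, hB i j hij, sub_zero]

theorem IsUpper.mul {m k : ℕ} {A B : Matrix (Fin N) (Fin N) ℤ} (hA : IsUpper m A)
    (hB : IsUpper k B) : IsUpper (m + k) (A * B) := fun i j hij => by
  rw [Matrix.mul_apply]
  refine Finset.sum_eq_zero fun l _ => ?_
  by_cases hl : (l : ℕ) < i + m
  · rw [hA i l hl, zero_mul]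
  · rw [hB l j (by omega), mul_zero]

theorem isUpper_one : IsUpper 0 (1 : Matrix (Fin N) (Fin N) ℤ) := fun i j hij =>
  Matrix.one_apply_ne fun h => by subst h; omega

theorem IsUpper.eq_zero {A : Matrix (Fin N) (Fin N) ℤ} (h : IsUpper N A) : A = 0 := by
  ext i j
  exact h i j (by omega)

variable (N) in
/-- The invertible matrices congruent to the identity up to the `m`-th superdiagonal. -/
def unitriangular (m : ℕ) : Subgroup (Matrix (Fin N) (Fin N) ℤ)ˣ where
  carrier := {g | IsUpper m ((g : Matrix (Fin N) (Fin N) ℤ) - 1) ∧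
    IsUpper m (((g⁻¹ : (Matrix (Fin N) (Fin N) ℤ)ˣ) : Matrix (Fin N) (Fin N) ℤ) - 1)}
  one_mem' := by simp [IsUpper]
  inv_mem' h := ⟨h.2, by simpa using h.1⟩
  mul_mem' {g h} hg hh := by
    have key : ∀ {A B : Matrix (Fin N) (Fin N) ℤ}, IsUpper m (A - 1) → IsUpper m (B - 1) →
        IsUpper m (A * B - 1) := fun {A B} hA hB => by
      rw [show A * B - 1 = (A - 1) * (B - 1) + (A - 1) + (B - 1) by noncomm_ring]
      exact (((hA.mul hB).mono (Nat.le_add_right _ _)).add hA).add hB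
    refine ⟨key hg.1 hh.1, ?_⟩
    rw [mul_inv_rev]
    exact key hh.2 hg.2

/-- From [g,h] - 1 = (gh - hg)(hg)⁻¹, where gh - hg is the Lie bracket of g - 1 and h - 1.
Consequently a representation by N × N unitriangular matrices kills Γ_N. -/
theorem commutator_unitriangular_le (m k : ℕ) :
    ⁅unitriangular N m, unitriangular N k⁆ ≤ unitriangular N (m + k) := by
  rw [Subgroup.commutator_le]
  have upper : ∀ {k : ℕ} {A : Matrix (Fin N) (Fin N) ℤ}, IsUpper k (A - 1) → IsUpper 0 A :=
    fun {k A} hA => by simpa using (hA.mono (Nat.zero_le k)).add isUpper_one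
  have key : ∀ {m k : ℕ} {g h : (Matrix (Fin N) (Fin N) ℤ)ˣ}, g ∈ unitriangular N m →
      h ∈ unitriangular N k →
      IsUpper (m + k) (((⁅g, h⁆ : (Matrix (Fin N) (Fin N) ℤ)ˣ) : Matrix (Fin N) (Fin N) ℤ) - 1) := by
    intro m k g h hg hh
    have e : ((⁅g, h⁆ : (Matrix (Fin N) (Fin N) ℤ)ˣ) : Matrix (Fin N) (Fin N) ℤ) - 1 =
        ((g.val - 1) * (h.val - 1) - (h.val - 1) * (g.val - 1)) *
          ((g⁻¹).val * (h⁻¹).val) := by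
      have h1 : (1 : Matrix (Fin N) (Fin N) ℤ) = h.val * g.val * ((g⁻¹).val * (h⁻¹).val) := by
        rw [← Units.val_mul, ← Units.val_mul, ← Units.val_mul, ← Units.val_one]
        congr 1
        group
      have h2 : (g.val - 1) * (h.val - 1) - (h.val - 1) * (g.val - 1) =
          g.val * h.val - h.val * g.val := by noncomm_ring
      rw [h2, sub_mul, ← h1, commutatorElement_def]
      simp only [Units.val_mul, mul_assoc]
    rw [e]
    exact (((hg.1.mul hh.1).sub (by rw [add_comm m k]; exact hh.1.mul hg.1)).mul
      ((upper hg.2).mul (upper hh.2)))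
  intro g hg h hh
  refine ⟨key hg hh, ?_⟩
  rw [commutatorElement_inv, add_comm m k]
  exact key hh hg

theorem map_gam_le_unitriangular {G : Type*} [Group G] (f : G →* (Matrix (Fin N) (Fin N) ℤ)ˣ)
    (hf : f.range ≤ unitriangular N 1) (n : ℕ) :
    (Gam G (n + 1)).map f ≤ unitriangular N (n + 1) := by
  induction n with
  | zero => exact (Subgroup.map_le_range f _).trans hf
  | succ n ih =>
    change (⁅Gam G (n + 1), (⊤ : Subgroup G)⁆).map f ≤ _
    rw [Subgroup.map_commutator, ← MonoidHom.range_eq_map]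
    exact (Subgroup.commutator_mono ih hf).trans (commutator_unitriangular_le _ _)

theorem eq_one_of_mem_unitriangular {g : (Matrix (Fin N) (Fin N) ℤ)ˣ}
    (hg : g ∈ unitriangular N N) : g = 1 :=
  Units.ext (sub_eq_zero.1 hg.1.eq_zero)

/-- Lets an explicit commutator be verified without multiplying out inverses. -/
theorem val_commutator_eq {R : Type*} [Ring R] {g h : Rˣ} {m : R}
    (e : g.val * h.val = m * (h.val * g.val)) : (⁅g, h⁆ : Rˣ).val = m := by
  have h1 : (⁅g, h⁆ : Rˣ).val * (h.val * g.val) = m * (h.val * g.val) := by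
    rw [← e, ← Units.val_mul, ← Units.val_mul, ← Units.val_mul]
    congr 1
    simp [commutatorElement_def]
  rw [← Units.val_mul h g] at h1
  exact (Units.mul_left_inj _).1 h1

end Unitriangular

/-! ### The class of `w` has infinite order -/

section Witness

/-- The unitriangular representation of `F_2` reading off the coefficient of the word
`xyyxxxyy`: the generators have ones on complementary parts of the superdiagonal. -/
def xUnit : (Matrix (Fin 9) (Fin 9) ℤ)ˣ where
  val := !![1, 1, 0, 0, 0, 0, 0, 0, 0;
    0, 1, 0, 0, 0, 0, 0, 0, 0;
    0, 0, 1, 0, 0, 0, 0, 0, 0;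
    0, 0, 0, 1, 1, 0, 0, 0, 0;
    0, 0, 0, 0, 1, 1, 0, 0, 0;
    0, 0, 0, 0, 0, 1, 1, 0, 0;
    0, 0, 0, 0, 0, 0, 1, 0, 0;
    0, 0, 0, 0, 0, 0, 0, 1, 0;
    0, 0, 0, 0, 0, 0, 0, 0, 1]
  inv := !![1, -1, 0, 0, 0, 0, 0, 0, 0;
    0, 1, 0, 0, 0, 0, 0, 0, 0;
    0, 0, 1, 0, 0, 0, 0, 0, 0;
    0, 0, 0, 1, -1, 1, -1, 0, 0;
    0, 0, 0, 0, 1, -1, 1, 0, 0;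
    0, 0, 0, 0, 0, 1, -1, 0, 0;
    0, 0, 0, 0, 0, 0, 1, 0, 0;
    0, 0, 0, 0, 0, 0, 0, 1, 0;
    0, 0, 0, 0, 0, 0, 0, 0, 1]
  val_inv := by decide +kernel
  inv_val := by decide +kernel

/-- The image of the second generator; see `xUnit`. -/
def yUnit : (Matrix (Fin 9) (Fin 9) ℤ)ˣ where
  val := !![1, 0, 0, 0, 0, 0, 0, 0, 0;
    0, 1, 1, 0, 0, 0, 0, 0, 0;
    0, 0, 1, 1, 0, 0, 0, 0, 0;
    0, 0, 0, 1, 0, 0, 0, 0, 0;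
    0, 0, 0, 0, 1, 0, 0, 0, 0;
    0, 0, 0, 0, 0, 1, 0, 0, 0;
    0, 0, 0, 0, 0, 0, 1, 1, 0;
    0, 0, 0, 0, 0, 0, 0, 1, 1;
    0, 0, 0, 0, 0, 0, 0, 0, 1]
  inv := !![1, 0, 0, 0, 0, 0, 0, 0, 0;
    0, 1, -1, 1, 0, 0, 0, 0, 0;
    0, 0, 1, -1, 0, 0, 0, 0, 0;
    0, 0, 0, 1, 0, 0, 0, 0, 0;
    0, 0, 0, 0, 1, 0, 0, 0, 0;
    0, 0, 0, 0, 0, 1, 0, 0, 0;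
    0, 0, 0, 0, 0, 0, 1, -1, 1;
    0, 0, 0, 0, 0, 0, 0, 1, -1;
    0, 0, 0, 0, 0, 0, 0, 0, 1]
  val_inv := by decide +kernel
  inv_val := by decide +kernel

theorem weightEight_unit :
    (weightEight xUnit yUnit).val = 1 + Matrix.single 0 8 (-1) := by
  have hB : (⁅xUnit, yUnit⁆).val = !![1, 0, 1, -1, 0, 0, 0, 0, 0;
    0, 1, 0, 0, 0, 0, 0, 0, 0;
    0, 0, 1, 0, -1, 1, -1, 1, -1;
    0, 0, 0, 1, 0, 0, 0, 0, 0;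
    0, 0, 0, 0, 1, 0, 0, 0, 0;
    0, 0, 0, 0, 0, 1, 0, 1, -1;
    0, 0, 0, 0, 0, 0, 1, 0, 0;
    0, 0, 0, 0, 0, 0, 0, 1, 0;
    0, 0, 0, 0, 0, 0, 0, 0, 1] :=
    val_commutator_eq (by decide +kernel)
  have hC : (⁅⁅xUnit, yUnit⁆, xUnit⁆).val = !![1, 0, 0, 0, -1, 1, -1, 0, 0;
    0, 1, 0, 0, 0, 0, 0, 0, 0;
    0, 0, 1, 0, 0, -1, 2, 1, -1;
    0, 0, 0, 1, 0, 0, 0, 0, 0;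
    0, 0, 0, 0, 1, 0, 0, -1, 1;
    0, 0, 0, 0, 0, 1, 0, 0, 0;
    0, 0, 0, 0, 0, 0, 1, 0, 0;
    0, 0, 0, 0, 0, 0, 0, 1, 0;
    0, 0, 0, 0, 0, 0, 0, 0, 1] :=
    val_commutator_eq (by rw [hB]; decide +kernel)
  have hD : (⁅⁅xUnit, yUnit⁆, yUnit⁆).val = !![1, 0, 0, 1, 0, 0, 0, 0, 0;
    0, 1, 0, 0, 1, -1, 1, -1, 1;
    0, 0, 1, 0, 0, 0, 0, -1, 2;
    0, 0, 0, 1, 0, 0, 0, 0, 0;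
    0, 0, 0, 0, 1, 0, 0, 0, 0;
    0, 0, 0, 0, 0, 1, 0, 0, 1;
    0, 0, 0, 0, 0, 0, 1, 0, 0;
    0, 0, 0, 0, 0, 0, 0, 1, 0;
    0, 0, 0, 0, 0, 0, 0, 0, 1] :=
    val_commutator_eq (by rw [hB]; decide +kernel)
  have hE : (⁅⁅⁅xUnit, yUnit⁆, xUnit⁆, ⁅⁅xUnit, yUnit⁆, yUnit⁆⁆).val = !![1, 0, 0, 0, 0, 0, 0, 0, 1;
    0, 1, 0, 0, 0, 0, 0, 1, -1;
    0, 0, 1, 0, 0, 0, 0, 0, -1;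
    0, 0, 0, 1, 0, 0, 0, 0, 0;
    0, 0, 0, 0, 1, 0, 0, 0, 0;
    0, 0, 0, 0, 0, 1, 0, 0, 0;
    0, 0, 0, 0, 0, 0, 1, 0, 0;
    0, 0, 0, 0, 0, 0, 0, 1, 0;
    0, 0, 0, 0, 0, 0, 0, 0, 1] :=
    val_commutator_eq (by rw [hC, hD]; decide +kernel)
  exact val_commutator_eq (by rw [hB, hE]; decide +kernel)

theorem weightEight_unit_zpow_ne_one {m : ℤ} (hm : m ≠ 0) : weightEight xUnit yUnit ^ m ≠ 1 := by
  intro h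
  have h1 : weightEight xUnit yUnit ^ m.natAbs = 1 := pow_natAbs_eq_one.2 h
  -- The corner matrix unit squares to zero, so powers add up in the corner entry.
  have key : ∀ k : ℕ, (weightEight xUnit yUnit ^ k).val = 1 + Matrix.single 0 8 (-(k : ℤ)) := by
    intro k
    induction k with
    | zero => simp
    | succ k ih =>
      rw [pow_succ, Units.val_mul, ih, weightEight_unit, mul_add, mul_one, add_mul, one_mul,
        Matrix.single_mul_single_of_ne _ _ _ _ (by decide), add_zero, add_assoc,
        ← Matrix.single_add]
      congr 2
      push_cast
      ring
  have h2 := congrFun (congrFun ((key m.natAbs).symm.trans (congrArg Units.val h1)) 0) 8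
  simp at h2
  exact hm h2

theorem range_lift_le_unitriangular :
    (FreeGroup.lift ![xUnit, yUnit]).range ≤ unitriangular 9 1 := by
  refine FreeGroup.range_lift_le ?_
  rintro _ ⟨i, rfl⟩
  fin_cases i
  · exact ⟨by decide +kernel, by decide +kernel⟩
  · exact ⟨by decide +kernel, by decide +kernel⟩

theorem lift_weightEight : FreeGroup.lift ![xUnit, yUnit]
    (weightEight (FreeGroup.of 0) (FreeGroup.of 1)) = weightEight xUnit yUnit := by
  simp [weightEight, map_commutatorElement]

theorem lift_eq_one_of_mem_gam {g : FreeGroup (Fin 2)} (hg : g ∈ Gam (FreeGroup (Fin 2)) 9) :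
    FreeGroup.lift ![xUnit, yUnit] g = 1 :=
  eq_one_of_mem_unitriangular
    (map_gam_le_unitriangular _ range_lift_le_unitriangular 8 (Subgroup.mem_map_of_mem _ hg))

theorem weightEight_freeGroup_zpow_notMem (m : ℤ) (hm : m ≠ 0) :
    weightEight (FreeGroup.of (0 : Fin 2)) (FreeGroup.of 1) ^ m ∉ Gam (FreeGroup (Fin 2)) 9 := by
  intro h
  refine weightEight_unit_zpow_ne_one hm ?_
  rw [← lift_weightEight, ← map_zpow]
  exact lift_eq_one_of_mem_gam h

theorem gam_quotient {G : Type*} [Group G] (K : Subgroup G) [K.Normal] (n : ℕ) :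
    Gam (G ⧸ K) n = (Gam G n).map (QuotientGroup.mk' K) := by
  rw [Subgroup.map_lowerCentralSeries, ← MonoidHom.range_eq_map, QuotientGroup.range_mk']

theorem weightEight_freeNilpotent_zpow_notMem {k : ℕ} (hk : 8 ≤ k) (m : ℤ) (hm : m ≠ 0) :
    weightEight (FreeNilpotentGroup.gen k 0) (FreeNilpotentGroup.gen k 1) ^ m ∉
      Gam (FreeNilpotentGroup 2 k) 9 := by
  intro h
  rw [gam_quotient] at h
  obtain ⟨g, hg, e⟩ := h
  refine weightEight_freeGroup_zpow_notMem m hm ?_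
  have : (QuotientGroup.mk g : FreeNilpotentGroup 2 k) = QuotientGroup.mk
      (weightEight (FreeGroup.of (0 : Fin 2)) (FreeGroup.of 1) ^ m) := e
  -- The quotient divides out only Γ_{k+1}, which lies in Γ_9 because k ≥ 8.
  have h2 : _ ∈ Gam (FreeGroup (Fin 2)) 9 :=
    Subgroup.lowerCentralSeries_antitone _ (by omega : 9 - 1 ≤ k + 1 - 1) (QuotientGroup.eq.1 this)
  exact (Subgroup.mul_mem_cancel_left _ (inv_mem hg)).1 h2

end Witness

/-! ### Automorphisms of two-generator groups -/

section TwoGenerators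
variable {G : Type*} [Group G] {x y : G}

theorem exists_gamEq_zpow_mul_zpow (hgen : Subgroup.closure {x, y} = ⊤) (g : G) :
    ∃ a b : ℤ, GamEq 2 g (x ^ a * y ^ b) := by
  have hcomm : ∀ g h : G, GamEq 2 (g * h) (h * g) := fun g h =>
    gamEq_mul_comm (mem_gam_one g) (mem_gam_one h) le_rfl
  have hg : g ∈ Subgroup.closure {x, y} := hgen ▸ Subgroup.mem_top g
  induction hg using Subgroup.closure_induction with
  | mem z hz =>
    rcases hz with rfl | rfl
    · exact ⟨1, 0, by simpa using GamEq.refl _⟩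
    · exact ⟨0, 1, by simpa using GamEq.refl _⟩
  | one => exact ⟨0, 0, by simpa using GamEq.refl _⟩
  | mul g h _ _ hg hh =>
    obtain ⟨a, b, e⟩ := hg
    obtain ⟨c, d, f⟩ := hh
    refine ⟨a + c, b + d, (e.mul f).trans ?_⟩
    have := ((GamEq.refl (x ^ a)).mul (hcomm (y ^ b) (x ^ c))).mul (GamEq.refl (y ^ d))
    simpa only [zpow_add, mul_assoc] using this
  | inv g _ hg =>
    obtain ⟨a, b, e⟩ := hg
    refine ⟨-a, -b, e.inv.trans ?_⟩
    rw [mul_inv_rev, zpow_neg, zpow_neg]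
    exact hcomm _ _

theorem map_weightEight {H : Type*} [Group H] (φ : G →* H) (x y : G) :
    φ (weightEight x y) = weightEight (φ x) (φ y) := by
  simp only [weightEight, map_commutatorElement]

theorem GamEq.map {n : ℕ} {g h : G} (φ : G →* G) (e : GamEq n g h) : GamEq n (φ g) (φ h) := by
  have := map_mem_Gam φ n (QuotientGroup.eq.1 e)
  rw [map_mul, map_inv] at this
  exact QuotientGroup.eq.2 this

theorem exists_gamEq_map_weightEight (hgen : Subgroup.closure {x, y} = ⊤) (φ : G →* G) :
    ∃ D : ℤ, GamEq 9 (φ (weightEight x y)) (weightEight x y ^ D ^ 4) := by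
  obtain ⟨a, b, e⟩ := exists_gamEq_zpow_mul_zpow hgen (φ x)
  obtain ⟨c, d, f⟩ := exists_gamEq_zpow_mul_zpow hgen (φ y)
  exact ⟨a * d - b * c, by rw [map_weightEight]; exact gamEq_weightEight e f⟩

/-- Automorphisms act on the class of `[B,[[B,x],[B,y]]]` by the fourth power of an invertible
determinant, that is, trivially. -/
theorem gamEq_map_weightEight (hgen : Subgroup.closure {x, y} = ⊤)
    (hw : ∀ m : ℤ, m ≠ 0 → weightEight x y ^ m ∉ Gam G 9) (φ : G ≃* G) :
    GamEq 9 (φ (weightEight x y)) (weightEight x y) := by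
  obtain ⟨D, e⟩ := exists_gamEq_map_weightEight hgen φ.toMonoidHom
  obtain ⟨D', e'⟩ := exists_gamEq_map_weightEight hgen φ.symm.toMonoidHom
  have h := e'.map φ.toMonoidHom
  rw [map_zpow] at h
  replace h := h.trans (e.zpow _)
  have h1 : φ.toMonoidHom (φ.symm.toMonoidHom (weightEight x y)) = weightEight x y :=
    φ.apply_symm_apply _
  rw [h1, ← zpow_mul] at h
  -- Composing φ with its inverse shows that D⁴D'⁴ acts as 1 on a class of infinite order, hence
  -- equals 1; as D⁴ ≥ 0, this forces D⁴ = 1.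
  have h2 : weightEight x y ^ (-1 + D ^ 4 * D' ^ 4) ∈ Gam G 9 := by
    rw [zpow_add, zpow_neg_one]
    exact QuotientGroup.eq.1 h
  have h3 : -1 + D ^ 4 * D' ^ 4 = 0 := by
    by_contra hne
    exact hw _ hne h2
  have h4 : D ^ 4 = 1 :=
    Int.eq_one_of_mul_eq_one_right (by positivity) (show D ^ 4 * D' ^ 4 = 1 by omega)
  rw [h4, zpow_one] at e
  exact e

/-- Weight 8 always carries a fixed class of infinite order; the first such weight may be smaller,
and `infinite_twistedConj` is applied there. -/
theorem hasRInfty_of_weightEight (hgen : Subgroup.closure {x, y} = ⊤)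
    (hw : ∀ m : ℤ, m ≠ 0 → weightEight x y ^ m ∉ Gam G 9) : HasRInfty G := by
  classical
  intro φ
  have : Group.FG G := Group.fg_iff.2 ⟨{x, y}, hgen, Set.toFinite _⟩
  have hmem := weightEight_mem x y
  have h8 : 1 ≤ 8 ∧ FixesInfiniteOrder φ.toMonoidHom 8 :=
    ⟨by norm_num, _, hmem, by
      have := (GamEq.refl (weightEight x y)).mul (gamEq_map_weightEight hgen hw φ).inv
      rw [mul_inv_cancel] at this
      exact gamEq_one_iff.1 this, hw⟩
  have hex : ∃ n, 1 ≤ n ∧ FixesInfiniteOrder φ.toMonoidHom n := ⟨8, h8⟩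
  rw [reidemeisterNumber, ENat.card_eq_top]
  exact infinite_twistedConj φ.toMonoidHom (Nat.find_spec hex).1
    (fun i hi hlt h => Nat.find_min hex hlt ⟨hi, h⟩) (Nat.find_spec hex).2

theorem weightEight_class_ne_one_and_fixed (hgen : Subgroup.closure {x, y} = ⊤)
    (hw : ∀ m : ℤ, m ≠ 0 → weightEight x y ^ m ∉ Gam G 9) :
    ∃ h : weightEight x y ∈ Gam G 8, (QuotientGroup.mk ⟨_, h⟩ : GamFactor G 8) ≠ 1 ∧
      ∀ φ : G ≃* G, gamFactorMap φ.toMonoidHom 8 (QuotientGroup.mk ⟨_, h⟩) =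
        QuotientGroup.mk ⟨_, h⟩ := by
  refine ⟨weightEight_mem x y, fun e => ?_, fun φ => ?_⟩
  · exact hw 1 one_ne_zero (by rw [zpow_one]; exact (gamFactor_mk_eq_one _).1 e)
  · exact (gamFactor_mk_eq (map_mem_Gam φ.toMonoidHom 8 (weightEight_mem x y)) _).2
      (gamEq_map_weightEight hgen hw φ)

end TwoGenerators

/-! ### Generators of F_2 and of its nilpotent quotients, and the conclusion -/

theorem closure_freeGroup_of :
    Subgroup.closure {FreeGroup.of (0 : Fin 2), FreeGroup.of 1} = ⊤ := by
  rw [← FreeGroup.closure_range_of, ← Set.image_univ, ← Finset.coe_univ]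
  simp [Fin.univ_succ, Set.image_pair]

theorem closure_freeNilpotent_gen (k : ℕ) :
    Subgroup.closure {FreeNilpotentGroup.gen (r := 2) k 0, FreeNilpotentGroup.gen k 1} = ⊤ := by
  have := congrArg (Subgroup.map (QuotientGroup.mk' (Gam (FreeGroup (Fin 2)) (k + 1))))
    closure_freeGroup_of
  rw [MonoidHom.map_closure, Set.image_pair, ← MonoidHom.range_eq_map,
    QuotientGroup.range_mk'] at this
  exact this

theorem mainTheorem1 :
    -- `G(2,k)` has the `R_∞` property for every finite `k ≥ 8`, and so has `F_2 = G(2,∞)`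
    (∀ k : ℕ, 8 ≤ k → HasRInfty (FreeNilpotentGroup 2 k)) ∧
    HasRInfty (FreeGroup (Fin 2)) ∧
    -- in `G = G(2,k)`, `8 ≤ k < ∞`, the element `[B,[[B,x],[B,y]]]` lies in `Γ_8(G)`, its class
    -- in `Γ_8(G)/Γ_9(G)` is nontrivial, and that class is fixed by the map induced by any
    -- automorphism `φ` of `G` with `det φ^{Ab} = -1`
    (∀ k : ℕ, 8 ≤ k →
      ∃ h : weightEight (FreeNilpotentGroup.gen k 0) (FreeNilpotentGroup.gen k 1) ∈
          Gam (FreeNilpotentGroup 2 k) 8,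
        (QuotientGroup.mk ⟨_, h⟩ : GamFactor (FreeNilpotentGroup 2 k) 8) ≠ 1 ∧
        ∀ φ : FreeNilpotentGroup 2 k ≃* FreeNilpotentGroup 2 k, abDet φ.toMonoidHom = -1 →
          gamFactorMap φ.toMonoidHom 8 (QuotientGroup.mk ⟨_, h⟩) = QuotientGroup.mk ⟨_, h⟩) ∧
    -- the same in `F_2`, the case `k = ∞`
    (∃ h : weightEight (FreeGroup.of (0 : Fin 2)) (FreeGroup.of 1) ∈ Gam (FreeGroup (Fin 2)) 8,
      (QuotientGroup.mk ⟨_, h⟩ : GamFactor (FreeGroup (Fin 2)) 8) ≠ 1 ∧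
      ∀ φ : FreeGroup (Fin 2) ≃* FreeGroup (Fin 2), abDet φ.toMonoidHom = -1 →
        gamFactorMap φ.toMonoidHom 8 (QuotientGroup.mk ⟨_, h⟩) = QuotientGroup.mk ⟨_, h⟩) := by
  have hF := weightEight_class_ne_one_and_fixed closure_freeGroup_of
    weightEight_freeGroup_zpow_notMem
  refine ⟨fun k hk => hasRInfty_of_weightEight (closure_freeNilpotent_gen k)
      (weightEight_freeNilpotent_zpow_notMem hk),
    hasRInfty_of_weightEight closure_freeGroup_of weightEight_freeGroup_zpow_notMem,
    fun k hk => ?_, hF.imp fun _ h => ⟨h.1, fun φ _ => h.2 φ⟩⟩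
  have hk := weightEight_class_ne_one_and_fixed (closure_freeNilpotent_gen k)
    (weightEight_freeNilpotent_zpow_notMem hk)
  exact hk.imp fun _ h => ⟨h.1, fun φ _ => h.2 φ⟩
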